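/- **Conventions.** A weight on $\mathbb Z$ is a function $\omega\colon\mathbb Z\to[1,\infty)$ with $\omega(0)=1$ and $\omega(m+n)\le\omega(m)\,\omega(n)$ for all $m,n\in\mathbb Z$. For a weight $\omega$, let $$\ell^1(\mathbb Z,\omega)=\Big\{f\colon\mathbb Z\to\mathbb C:\ \|f\|_\omega=\sum_{n\in\mathbb Z}|f(n)|\,\omega(n)<\infty\Big\},$$ a unital Banach algebra under convolution, and let $\delta_n\in\ell^1(\mathbb Z,\omega)$ be the point mass at $n$. For a Banach algebra $A$ the bidual $A''$ is regarded as a Banach algebra under the first Arens product $\Box$, given by $$\langle\Psi\,\Box\,\Phi,\lambda\rangle=\langle\Psi,\Phi\cdot\lambda\rangle,\qquad \langle\Phi\cdot\lambda,a\rangle=\langle\Phi,\lambda\cdot a\rangle,\qquad \langle\lambda\cdot a,b\rangle=\langle\lambda,ab\rangle$$ for $\Phi,\Psi\in A''$, $\lambda\in A'$, $a,b\in A$; $\operatorname{rad}(A'')$ denotes its Jacobson radical. For a set $S\subset\mathbb Z$ generating $\mathbb Z$ as a group, the word length $|n|_S$ is the least $r\ge 0$ such that $n=\sum_{i=1}^r\varepsilon_i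 s_i$ for some $s_1,\dots,s_r\in S$ and $\varepsilon_1,\dots,\varepsilon_r\in\{1,-1\}$. **Theorem 1.2.** There exists a weight $\omega$ on $\mathbb Z$ such that $\operatorname{rad}(\ell^1(\mathbb Z,\omega)'')$ contains an element that is not nilpotent. More precisely, let $S=\{2^{k^2}:k=0,1,2,\dots\}$, let $\omega(n)=e^{|n|_S}$ for $n\in\mathbb Z$, and let $n_k=2^{k^2}+2^{(k-1)^2}+\cdots+2^{1}+1=\sum_{i=0}^{k}2^{i^2}$ for $k=1,2,\dots$. Then $\omega$ is a weight on $\mathbb Z$; the set $\{\delta_{n_k}/\omega(n_k):k\ge 1\}$ has a weak-* accumulation point in $\ell^1(\mathbb Z,\omega)''$; and every weak-* accumulation point of this set in $\ell^1(\mathbb Z,\omega)''$ belongs to $\operatorname{rad}(\ell^1(\mathbb Z,\omega)'')$ and is not nilpotent. -/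

import Mathlib

/-! ## The bidual of a normed algebra with the first Arens product -/

section Arens

variable {A : Type*} [NormedRing A] [NormedAlgebra ℂ A]

/-- The bidual `A''` of a complex normed algebra `A`, which carries the first Arens product. -/
def Bidual (A : Type*) [NormedRing A] [NormedAlgebra ℂ A] : Type _ :=
  StrongDual ℂ (StrongDual ℂ A)

namespace Bidual

noncomputable instance : NormedAddCommGroup (Bidual A) :=
  inferInstanceAs (NormedAddCommGroup (StrongDual ℂ (StrongDual ℂ A)))

noncomputable instance : NormedSpace ℂ (Bidual A) :=
  inferInstanceAs (NormedSpace ℂ (StrongDual ℂ (StrongDual ℂ A)))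

instance : CompleteSpace (Bidual A) :=
  inferInstanceAs (CompleteSpace (StrongDual ℂ (StrongDual ℂ A)))

/-- An element of `A''` as a functional on `A'`. -/
def toFunctional (Φ : Bidual A) : StrongDual ℂ (StrongDual ℂ A) := Φ

/-- A functional on `A'` as an element of `A''`. -/
def ofFunctional (Φ : StrongDual ℂ (StrongDual ℂ A)) : Bidual A := Φ

@[ext] theorem ext {Φ Ψ : Bidual A} (h : ∀ l, Φ.toFunctional l = Ψ.toFunctional l) : Φ = Ψ :=
  ContinuousLinearMap.ext h

/-- `A''` as a set of points of the weak-* dual of `A'`. -/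
noncomputable def toWeakStar (Φ : Bidual A) : WeakDual ℂ (StrongDual ℂ A) :=
  StrongDual.toWeakDual Φ.toFunctional

/-- The canonical embedding of `A` in `A''`. -/
noncomputable def embed (a : A) : Bidual A :=
  ofFunctional (NormedSpace.inclusionInDoubleDual ℂ A a)

/-- The map `a ↦ l · a` from `A` to `A'`, where `⟨l · a, b⟩ = ⟨l, a b⟩`. -/
noncomputable def dualAct (l : StrongDual ℂ A) : A →L[ℂ] StrongDual ℂ A :=
  (ContinuousLinearMap.compL ℂ A A ℂ l).comp (ContinuousLinearMap.mul ℂ A)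

@[simp] theorem dualAct_apply (l : StrongDual ℂ A) (a b : A) : dualAct l a b = l (a * b) := rfl

theorem norm_dualAct_le (l : StrongDual ℂ A) : ‖dualAct l‖ ≤ ‖l‖ := by
  refine ContinuousLinearMap.opNorm_le_bound _ (norm_nonneg _) fun a => ?_
  refine ContinuousLinearMap.opNorm_le_bound _ (by positivity) fun b => ?_
  rw [dualAct_apply, mul_assoc]
  exact (l.le_opNorm _).trans (by gcongr; exact norm_mul_le a b)

/-- The map `l ↦ Φ · l` from `A'` to `A'`, where `⟨Φ · l, a⟩ = ⟨Φ, l · a⟩`. -/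
noncomputable def act (Φ : Bidual A) : StrongDual ℂ A →L[ℂ] StrongDual ℂ A :=
  LinearMap.mkContinuous
    { toFun := fun l => Φ.toFunctional.comp (dualAct l)
      map_add' := fun l m => by
        ext a
        have h : dualAct (l + m) a = dualAct l a + dualAct m a := by ext b; simp
        simp [h]
      map_smul' := fun c l => by
        ext a
        have h : dualAct (c • l) a = c • dualAct l a := by ext b; simp
        simp [h] }
    ‖Φ‖ fun l =>
      (ContinuousLinearMap.opNorm_comp_le _ _).trans
        (mul_le_mul_of_nonneg_left (norm_dualAct_le l) (norm_nonneg _))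

@[simp] theorem act_apply (Φ : Bidual A) (l : StrongDual ℂ A) (a : A) :
    act Φ l a = Φ.toFunctional (dualAct l a) := rfl

theorem norm_act_le (Φ : Bidual A) : ‖act Φ‖ ≤ ‖Φ‖ :=
  LinearMap.mkContinuous_norm_le _ (norm_nonneg _) _

/-- The first Arens product: `⟨Ψ □ Φ, l⟩ = ⟨Ψ, Φ · l⟩`. -/
noncomputable instance : Mul (Bidual A) :=
  ⟨fun Ψ Φ => ofFunctional (Ψ.toFunctional.comp (act Φ))⟩

noncomputable instance : One (Bidual A) := ⟨embed 1⟩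

@[simp] theorem mul_apply (Ψ Φ : Bidual A) (l : StrongDual ℂ A) :
    (Ψ * Φ).toFunctional l = Ψ.toFunctional (act Φ l) := rfl

@[simp] theorem embed_apply (a : A) (l : StrongDual ℂ A) : (embed a).toFunctional l = l a := rfl

@[simp] theorem one_apply (l : StrongDual ℂ A) : (1 : Bidual A).toFunctional l = l 1 := rfl

@[simp] theorem add_apply (Φ Ψ : Bidual A) (l : StrongDual ℂ A) :
    (Φ + Ψ).toFunctional l = Φ.toFunctional l + Ψ.toFunctional l := rfl

@[simp] theorem smul_apply (c : ℂ) (Φ : Bidual A) (l : StrongDual ℂ A) :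
    (c • Φ).toFunctional l = c * Φ.toFunctional l := rfl

@[simp] theorem zero_apply (l : StrongDual ℂ A) : (0 : Bidual A).toFunctional l = 0 := rfl

theorem act_one (l : StrongDual ℂ A) : act 1 l = l := by
  ext a; simp

theorem act_mul (Ψ Φ : Bidual A) (l : StrongDual ℂ A) : act (Ψ * Φ) l = act Ψ (act Φ l) := by
  ext a
  have h : act Φ (dualAct l a) = dualAct (act Φ l) a := by
    ext b
    have h' : dualAct (dualAct l a) b = dualAct l (a * b) := by ext c; simp [mul_assoc]
    simp [h']
  simp [h]

theorem norm_arens_le (Ψ Φ : Bidual A) : ‖Ψ * Φ‖ ≤ ‖Ψ‖ * ‖Φ‖ :=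
  (ContinuousLinearMap.opNorm_comp_le Ψ.toFunctional (act Φ)).trans
    (mul_le_mul_of_nonneg_left (norm_act_le Φ) (norm_nonneg _))

noncomputable instance : NormedRing (Bidual A) where
  __ := (inferInstance : NormedAddCommGroup (Bidual A))
  mul := (· * ·)
  one := 1
  left_distrib Φ Ψ Θ := by
    ext l
    have h : act (Ψ + Θ) l = act Ψ l + act Θ l := by ext a; simp
    change Φ.toFunctional (act (Ψ + Θ) l) = _
    rw [h, map_add]; rfl
  right_distrib Φ Ψ Θ := by ext l; rfl
  zero_mul Φ := by ext l; rfl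
  mul_zero Φ := by
    ext l
    have h : act 0 l = 0 := by ext a; simp
    change Φ.toFunctional (act 0 l) = _
    rw [h, map_zero]; rfl
  mul_assoc Φ Ψ Θ := by
    ext l
    change Φ.toFunctional (act Ψ (act Θ l)) = Φ.toFunctional (act (Ψ * Θ) l)
    rw [act_mul]
  one_mul Φ := by
    ext l
    change act Φ l 1 = _
    rw [act_apply]
    congr 1
    ext a; simp
  mul_one Φ := by
    ext l
    change Φ.toFunctional (act 1 l) = _
    rw [act_one]
  norm_mul_le := norm_arens_le

noncomputable instance : NormedAlgebra ℂ (Bidual A) where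
  __ := Algebra.ofModule (R := ℂ) (A := Bidual A) (fun c Φ Ψ => by ext l; rfl) (fun c Φ Ψ => by
    ext l
    have h : act (c • Ψ) l = c • act Ψ l := by ext a; simp
    change Φ.toFunctional (act (c • Ψ) l) = c • Φ.toFunctional (act Ψ l)
    rw [h, map_smul])
  norm_smul_le := norm_smul_le

end Bidual

end Arens

/-! ## Beurling algebras on the integers -/

/-- A weight on `ℤ`: a submultiplicative function `ℤ → [1, ∞)` with value `1` at `0`. -/
structure Weight where
  toFun : ℤ → ℝ
  one_le' : ∀ n, 1 ≤ toFun n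
  map_add_le' : ∀ m n, toFun (m + n) ≤ toFun m * toFun n
  map_zero' : toFun 0 = 1

namespace Weight

instance : CoeFun Weight fun _ => ℤ → ℝ := ⟨toFun⟩

theorem one_le (ω : Weight) (n : ℤ) : 1 ≤ ω n := ω.one_le' n

theorem nonneg (ω : Weight) (n : ℤ) : 0 ≤ ω n := zero_le_one.trans (ω.one_le n)

end Weight

/-- The functions `f : ℤ → ℂ` such that `∑ |f n| ω n < ∞`. -/
def beurlingSubmodule (ω : Weight) : Submodule ℂ (ℤ → ℂ) where
  carrier := {f | Summable fun n => ‖f n‖ * ω n}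
  zero_mem' := by simp
  add_mem' {f g} hf hg := by
    refine Summable.of_nonneg_of_le (fun n => mul_nonneg (norm_nonneg _) (ω.nonneg n))
      (fun n => ?_) (Summable.add hf hg)
    rw [← add_mul]
    exact mul_le_mul_of_nonneg_right (norm_add_le _ _) (ω.nonneg n)
  smul_mem' c f hf := by
    refine (Summable.mul_left ‖c‖ hf).congr fun n => ?_
    simp [mul_assoc]

/-- The Beurling algebra `ℓ¹(ℤ, ω)`. -/
def Beurling (ω : Weight) : Type := beurlingSubmodule ω

namespace Beurling

variable {ω : Weight}

noncomputable instance : AddCommGroup (Beurling ω) :=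
  inferInstanceAs (AddCommGroup (beurlingSubmodule ω))

noncomputable instance : Module ℂ (Beurling ω) :=
  inferInstanceAs (Module ℂ (beurlingSubmodule ω))

instance : CoeFun (Beurling ω) fun _ => ℤ → ℂ := ⟨fun f => f.1⟩

@[ext] theorem ext {f g : Beurling ω} (h : ∀ n, f n = g n) : f = g := Subtype.ext (funext h)

@[simp] theorem add_apply (f g : Beurling ω) (n : ℤ) : (f + g) n = f n + g n := rfl
@[simp] theorem neg_apply (f : Beurling ω) (n : ℤ) : (-f) n = -f n := rfl
@[simp] theorem zero_apply (n : ℤ) : (0 : Beurling ω) n = 0 := rfl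
@[simp] theorem smul_apply (c : ℂ) (f : Beurling ω) (n : ℤ) : (c • f) n = c * f n := rfl

theorem summable_weighted (f : Beurling ω) : Summable fun n => ‖f n‖ * ω n := f.2

theorem summable_norm (f : Beurling ω) : Summable fun n => ‖f n‖ :=
  Summable.of_nonneg_of_le (fun _ => norm_nonneg _)
    (fun n => le_mul_of_one_le_right (norm_nonneg _) (ω.one_le n)) f.summable_weighted

/-- The norm `‖f‖ = ∑ |f n| ω n`. -/
noncomputable instance : Norm (Beurling ω) := ⟨fun f => ∑' n, ‖f n‖ * ω n⟩

theorem norm_def (f : Beurling ω) : ‖f‖ = ∑' n, ‖f n‖ * ω n := rfl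

theorem weighted_nonneg (f : Beurling ω) (n : ℤ) : 0 ≤ ‖f n‖ * ω n :=
  mul_nonneg (norm_nonneg _) (ω.nonneg n)

theorem normCore : NormedSpace.Core ℂ (Beurling ω) where
  norm_nonneg f := tsum_nonneg f.weighted_nonneg
  norm_smul c f := by
    simp only [norm_def, smul_apply, norm_mul, mul_assoc]
    exact tsum_mul_left
  norm_triangle f g := by
    rw [norm_def, norm_def, norm_def, ← f.summable_weighted.tsum_add g.summable_weighted]
    refine (f + g).summable_weighted.tsum_le_tsum (fun n => ?_)
      (f.summable_weighted.add g.summable_weighted)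
    rw [← add_mul]
    exact mul_le_mul_of_nonneg_right (norm_add_le _ _) (ω.nonneg n)
  norm_eq_zero_iff f := by
    constructor
    · intro h
      have h0 := (hasSum_zero_iff_of_nonneg f.weighted_nonneg).1
        (by rw [← h]; exact f.summable_weighted.hasSum)
      ext n
      have hn := congrFun h0 n
      have hω : ω n ≠ 0 := (zero_lt_one.trans_le (ω.one_le n)).ne'
      simpa [hω] using hn
    · rintro rfl
      simp [norm_def]

noncomputable instance : NormedAddCommGroup (Beurling ω) := NormedAddCommGroup.ofCore normCore

noncomputable instance : NormedSpace ℂ (Beurling ω) := NormedSpace.ofCore normCore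

/-- The bijection `(n, m) ↦ (m, n - m)` of `ℤ × ℤ`. -/
def shear : ℤ × ℤ ≃ ℤ × ℤ where
  toFun p := (p.2, p.1 - p.2)
  invFun p := (p.1 + p.2, p.1)
  left_inv p := by ext <;> simp
  right_inv p := by ext <;> simp

theorem summable_pair (f g : Beurling ω) :
    Summable fun p : ℤ × ℤ => (‖f p.2‖ * ω p.2) * (‖g (p.1 - p.2)‖ * ω (p.1 - p.2)) :=
  shear.summable_iff.2 (f.summable_weighted.mul_of_nonneg g.summable_weighted
    f.weighted_nonneg g.weighted_nonneg)

theorem tsum_pair (f g : Beurling ω) :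
    ∑' p : ℤ × ℤ, (‖f p.2‖ * ω p.2) * (‖g (p.1 - p.2)‖ * ω (p.1 - p.2)) = ‖f‖ * ‖g‖ := by
  rw [norm_def, norm_def, f.summable_weighted.tsum_mul_tsum g.summable_weighted
    (f.summable_weighted.mul_of_nonneg g.summable_weighted f.weighted_nonneg g.weighted_nonneg)]
  exact shear.tsum_eq fun p : ℤ × ℤ => (‖f p.1‖ * ω p.1) * (‖g p.2‖ * ω p.2)

theorem summable_pair_norm (f g : Beurling ω) :
    Summable fun p : ℤ × ℤ => ‖f p.2‖ * ‖g (p.1 - p.2)‖ :=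
  shear.summable_iff.2 (f.summable_norm.mul_of_nonneg g.summable_norm
    (fun _ => norm_nonneg _) (fun _ => norm_nonneg _))

theorem summable_conv (f g : Beurling ω) (n : ℤ) : Summable fun m => f m * g (n - m) := by
  refine Summable.of_norm ?_
  simpa using (f.summable_pair_norm g).prod_factor n

theorem norm_conv_le (f g : Beurling ω) (n : ℤ) :
    ‖∑' m, f m * g (n - m)‖ * ω n ≤
      ∑' m, (‖f m‖ * ω m) * (‖g (n - m)‖ * ω (n - m)) := by
  have hs : Summable fun m => ‖f m * g (n - m)‖ := by
    simpa using (f.summable_pair_norm g).prod_factor n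
  calc ‖∑' m, f m * g (n - m)‖ * ω n
      ≤ (∑' m, ‖f m * g (n - m)‖) * ω n :=
        mul_le_mul_of_nonneg_right (norm_tsum_le_tsum_norm hs) (ω.nonneg n)
    _ = ∑' m, ‖f m * g (n - m)‖ * ω n := tsum_mul_right.symm
    _ ≤ _ := by
      refine (hs.mul_right _).tsum_le_tsum (fun m => ?_) ((f.summable_pair g).prod_factor n)
      have h := ω.map_add_le' m (n - m)
      rw [add_sub_cancel] at h
      rw [norm_mul]
      calc ‖f m‖ * ‖g (n - m)‖ * ω n ≤ ‖f m‖ * ‖g (n - m)‖ * (ω m * ω (n - m)) :=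
            mul_le_mul_of_nonneg_left h (by positivity)
        _ = _ := by ring

/-- Convolution: `(f * g) n = ∑ₘ f m g (n - m)`. -/
noncomputable instance : Mul (Beurling ω) :=
  ⟨fun f g => ⟨fun n => ∑' m, f m * g (n - m),
    Summable.of_nonneg_of_le (fun n => mul_nonneg (norm_nonneg _) (ω.nonneg n))
      (f.norm_conv_le g) (f.summable_pair g).prod⟩⟩

theorem mul_apply (f g : Beurling ω) (n : ℤ) : (f * g) n = ∑' m, f m * g (n - m) := rfl

theorem norm_mul_le' (f g : Beurling ω) : ‖f * g‖ ≤ ‖f‖ * ‖g‖ := by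
  rw [← tsum_pair, (f.summable_pair g).tsum_prod]
  exact (f * g).summable_weighted.tsum_le_tsum (f.norm_conv_le g) (f.summable_pair g).prod

/-- The point mass at `k`. -/
noncomputable def delta (ω : Weight) (k : ℤ) : Beurling ω :=
  ⟨Pi.single k 1, summable_of_ne_finset_zero (s := {k}) fun n hn => by
    rw [Pi.single_eq_of_ne (by simpa using hn)]; simp⟩

theorem delta_apply (k n : ℤ) : delta ω k n = if n = k then 1 else 0 :=
  Pi.single_apply k 1 n

noncomputable instance : One (Beurling ω) := ⟨delta ω 0⟩

theorem mul_comm' (f g : Beurling ω) : f * g = g * f := by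
  ext n
  rw [mul_apply, mul_apply, ← (Equiv.subLeft n).tsum_eq]
  exact tsum_congr fun m => by simp [mul_comm]

theorem one_mul' (f : Beurling ω) : 1 * f = f := by
  ext n
  change ∑' m, delta ω 0 m * f (n - m) = f n
  rw [tsum_eq_single 0 fun m hm => by simp [delta_apply, hm]]
  simp [delta_apply]

theorem add_mul' (f g h : Beurling ω) : (f + g) * h = f * h + g * h := by
  ext n
  rw [add_apply, mul_apply, mul_apply, mul_apply,
    ← (f.summable_conv h n).tsum_add (g.summable_conv h n)]
  exact tsum_congr fun m => by rw [add_apply, add_mul]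

theorem mul_assoc' (f g h : Beurling ω) : f * g * h = f * (g * h) := by
  ext n
  have hb : ∀ m, ‖h m‖ ≤ ∑' k, ‖h k‖ := fun m =>
    h.summable_norm.le_tsum m fun _ _ => norm_nonneg _
  have hF : Summable fun p : ℤ × ℤ => f p.2 * g (p.1 - p.2) * h (n - p.1) := by
    refine Summable.of_norm_bounded ((f.summable_pair_norm g).mul_right (∑' k, ‖h k‖))
      fun p => ?_
    rw [norm_mul, norm_mul]
    exact mul_le_mul_of_nonneg_left (hb _) (by positivity)
  have h1 : ∀ m, (f * g) m * h (n - m) = ∑' k, f k * g (m - k) * h (n - m) := fun m => by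
    rw [mul_apply, tsum_mul_right]
  have h2 : ∀ k, f k * (g * h) (n - k) = ∑' m, f k * g (m - k) * h (n - m) := fun k => by
    rw [mul_apply, ← tsum_mul_left, ← (Equiv.subRight k).tsum_eq]
    refine tsum_congr fun m => ?_
    rw [Equiv.subRight_apply, sub_sub_sub_cancel_right, mul_assoc]
  rw [mul_apply (f * g) h, mul_apply f (g * h), tsum_congr h1, tsum_congr h2]
  exact (Summable.tsum_comm (f := fun m k => f k * g (m - k) * h (n - m)) hF).symm

noncomputable instance : NormedCommRing (Beurling ω) where
  __ := (inferInstance : NormedAddCommGroup (Beurling ω))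
  mul := (· * ·)
  one := 1
  left_distrib f g h := by
    rw [mul_comm' f, add_mul', mul_comm' g, mul_comm' h]
  right_distrib := add_mul'
  zero_mul f := by ext n; simp [mul_apply]
  mul_zero f := by ext n; simp [mul_apply]
  mul_assoc := mul_assoc'
  one_mul := one_mul'
  mul_one f := by rw [mul_comm', one_mul']
  mul_comm := mul_comm'
  norm_mul_le := norm_mul_le'

noncomputable instance : NormedAlgebra ℂ (Beurling ω) where
  __ := Algebra.ofModule (R := ℂ) (A := Beurling ω)
    (fun c f g => by
      ext n
      rw [smul_apply, mul_apply, mul_apply, ← tsum_mul_left]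
      exact tsum_congr fun m => by rw [smul_apply, mul_assoc])
    (fun c f g => by
      ext n
      rw [smul_apply, mul_apply, mul_apply, ← tsum_mul_left]
      exact tsum_congr fun m => by rw [smul_apply, mul_left_comm])
  norm_smul_le := norm_smul_le

end Beurling

/-! ## Word length -/

/-- The word length of `n` with respect to a generating set `S` of `ℤ`: the least `r` such that `n`
is a sum of `r` terms `± s` with `s ∈ S`. -/
noncomputable def wordLength (S : Set ℤ) (n : ℤ) : ℕ :=
  sInf {r : ℕ | ∃ s ε : Fin r → ℤ,
    (∀ i, s i ∈ S) ∧ (∀ i, ε i = 1 ∨ ε i = -1) ∧ n = ∑ i, ε i * s i}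

/-- The set `{2 ^ (k ^ 2) : k = 0, 1, 2, …}`. -/
def squarePowers : Set ℤ := Set.range fun k : ℕ => 2 ^ (k ^ 2)

/-- `n_k = 2 ^ (k ^ 2) + 2 ^ ((k - 1) ^ 2) + ⋯ + 1`. -/
def squarePowerSum (k : ℕ) : ℤ := ∑ i ∈ Finset.range (k + 1), 2 ^ (i ^ 2)

/-- The set `{δ_{n_k} / ω(n_k) : k = 1, 2, …}` in the bidual of `ℓ¹(ℤ, ω)`, with the weak-*
topology. -/
noncomputable def normalizedPointMasses (ω : Weight) :
    Set (WeakDual ℂ (StrongDual ℂ (Beurling ω))) :=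
  {x | ∃ k : ℕ, 1 ≤ k ∧ x = (Bidual.embed
    ((ω (squarePowerSum k) : ℂ)⁻¹ • Beurling.delta ω (squarePowerSum k))).toWeakStar}

/-! ## Powers in the bidual of a commutative normed algebra -/

section BidualPowers

variable {A : Type*} [NormedCommRing A] [NormedAlgebra ℂ A]

namespace Bidual

/-! A product of `r` normalized point masses at `n_{k_1}, …, n_{k_r}` has norm `exp(|∑ n_{k_i}| - ∑
|n_{k_i}|)`, so everything depends on how far word length fails to be additive on the `n_k`.

For fixed `r` the defect is bounded. The gaps between the exponents `l ^ 2` grow, so carrying can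
shorten a sum of `r` of the `n_k` only at a few low positions, and at most `2 * r ^ 2` letters are
saved (`sum_le_wordLength_add`). Pairing with `ω` itself then keeps `Φ ^ r` away from `0`, so `Φ` is
not nilpotent.

For `r = 2 ^ J ^ 2` and all `k_i ≥ J` the defect is large. The `r` copies of `∑ i < J, 2 ^ i ^ 2`
use `r * J` letters, yet their sum is at most `r` copies of the single generator `2 ^ J ^ 2`
(`wordLength_sum_squarePowerSum_add_le`). Hence such products have norm at most `exp(3 - J) ^ r`. An
accumulation point ignores finitely many `k`, so `J` is at our disposal, and some power of `Ψ * Φ`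
has norm below `1` for every `Ψ`. This puts `Φ` in the radical.

Both bounds pass from products in `A` to the bidual through iterated weak-* limits
(`pow_toFunctional_mem`, `norm_pow_le`). -/

theorem toFunctional_mem_of_mem_closure {T : Set A} {Φ : Bidual A}
    (hΦ : Φ.toWeakStar ∈ closure ((fun a => (embed a).toWeakStar) '' T))
    {D : Set ℂ} (hD : IsClosed D) (l : StrongDual ℂ A) (hl : ∀ a ∈ T, l a ∈ D) :
    Φ.toFunctional l ∈ D := by
  have hc : IsClosed {x : WeakDual ℂ (StrongDual ℂ A) | x l ∈ D} :=
    hD.preimage (WeakDual.eval_continuous l)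
  have hs : (fun a => (embed a).toWeakStar) '' T ⊆
      {x : WeakDual ℂ (StrongDual ℂ A) | x l ∈ D} := by
    rintro _ ⟨a, ha, rfl⟩
    exact hl a ha
  exact closure_minimal hs hc hΦ

/-- An Arens power is an iterated weak-* limit of products of elements of `T`. Each induction step
releases one factor, and commutativity of `A` moves it to the front of the list. -/
theorem pow_toFunctional_mem {T : Set A} {Φ : Bidual A}
    (hΦ : Φ.toWeakStar ∈ closure ((fun a => (embed a).toWeakStar) '' T))
    {D : Set ℂ} (hD : IsClosed D) (r : ℕ) (l : StrongDual ℂ A)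
    (hl : ∀ L : List A, L.length = r → (∀ a ∈ L, a ∈ T) → l L.prod ∈ D) :
    (Φ ^ r).toFunctional l ∈ D := by
  induction r generalizing l with
  | zero => simpa using hl [] rfl (by simp)
  | succ r ih =>
    rw [pow_succ, mul_apply]
    refine ih _ fun L hL hT => toFunctional_mem_of_mem_closure hΦ hD _ fun a ha => ?_
    have h := hl (a :: L) (by simp [hL]) (by simpa using ⟨ha, hT⟩)
    rwa [List.prod_cons, mul_comm] at h

theorem dualAct_act (Φ : Bidual A) (l : StrongDual ℂ A) (a : A) :
    dualAct (act Φ l) a = act Φ (dualAct l a) := by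
  ext b
  have h : dualAct (dualAct l a) b = dualAct l (a * b) := by ext c; simp [mul_assoc]
  simp [h]

/-- The factors `Ψ` need not be limits from `T`, so they are peeled off at a cost of `‖Ψ‖` each.
They commute with the action of `A`, which lets the elements of `T` approximating the successive `Φ`
collect into one product. The bound concerns `l · a` rather than `l a` so that it survives the
action of `Ψ`. -/
theorem norm_act_pow_le {T : Set A} {Φ : Bidual A}
    (hΦ : Φ.toWeakStar ∈ closure ((fun a => (embed a).toWeakStar) '' T)) (Ψ : Bidual A)
    (r : ℕ) (C : ℝ) (l : StrongDual ℂ A)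
    (hl : ∀ L : List A, L.length = r → (∀ a ∈ L, a ∈ T) → ‖dualAct l L.prod‖ ≤ C) :
    ‖act ((Ψ * Φ) ^ r) l‖ ≤ ‖Ψ‖ ^ r * C := by
  induction r generalizing l C with
  | zero =>
    have h := hl [] rfl (by simp)
    have h1 : dualAct l 1 = l := by ext b; simp
    rw [List.prod_nil, h1] at h
    simpa [act_one] using h
  | succ r ih =>
    rw [pow_succ, act_mul, pow_succ, mul_assoc]
    refine ih _ _ fun L hL hT => ?_
    rw [act_mul, dualAct_act, dualAct_act]
    have hC : 0 ≤ C := by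
      have hΦ' : ((fun a => (embed a).toWeakStar) '' T).Nonempty := closure_nonempty_iff.1 ⟨_, hΦ⟩
      obtain ⟨_, a, ha, -⟩ := hΦ'
      exact (norm_nonneg _).trans (hl (a :: L) (by simp [hL]) (by simpa using ⟨ha, hT⟩))
    refine ((act Ψ).le_of_opNorm_le (norm_act_le Ψ) _).trans ?_
    refine mul_le_mul_of_nonneg_left ?_ (norm_nonneg _)
    refine ContinuousLinearMap.opNorm_le_bound _ hC fun b => ?_
    have hm := toFunctional_mem_of_mem_closure hΦ
      (Metric.isClosed_closedBall (x := (0 : ℂ)) (ε := C * ‖b‖))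
      (dualAct (dualAct l L.prod) b) fun a ha => ?_
    · simpa using hm
    · have h := (dualAct l (a :: L).prod).le_of_opNorm_le
        (hl (a :: L) (by simp [hL]) (by simpa using ⟨ha, hT⟩)) b
      rw [mem_closedBall_zero_iff]
      have he : dualAct (dualAct l L.prod) b a = dualAct l (a :: L).prod b := by
        simp only [dualAct_apply, List.prod_cons]
        congr 1
        ring
      rwa [he]

theorem norm_pow_le {T : Set A} {Φ : Bidual A}
    (hΦ : Φ.toWeakStar ∈ closure ((fun a => (embed a).toWeakStar) '' T)) (Ψ : Bidual A)
    {r : ℕ} {C : ℝ} (hC : 0 ≤ C)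
    (hT : ∀ L : List A, L.length = r → (∀ a ∈ L, a ∈ T) → ‖L.prod‖ ≤ C) :
    ‖(Ψ * Φ) ^ r‖ ≤ ‖Ψ‖ ^ r * C * ‖(1 : A)‖ := by
  refine ContinuousLinearMap.opNorm_le_bound _ (by positivity) fun l => ?_
  have h : ‖act ((Ψ * Φ) ^ r) l‖ ≤ ‖Ψ‖ ^ r * (‖l‖ * C) :=
    norm_act_pow_le hΦ Ψ r _ l fun L hL hLT =>
      ((dualAct l).le_of_opNorm_le (norm_dualAct_le l) _).trans
        (mul_le_mul_of_nonneg_left (hT L hL hLT) (norm_nonneg _))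
  -- Evaluation at `1` recovers a functional from its action; this produces the factor `‖(1 : A)‖`.
  have h1 : ((Ψ * Φ) ^ r).toFunctional l = act ((Ψ * Φ) ^ r) l 1 := by
    rw [act_apply]
    congr 1
    ext b
    simp
  change ‖((Ψ * Φ) ^ r).toFunctional l‖ ≤ _
  rw [h1]
  exact ((act ((Ψ * Φ) ^ r) l).le_of_opNorm_le h 1).trans_eq (by ring)

end Bidual

end BidualPowers

/-! ### Small powers and the Jacobson radical -/

theorem isUnit_one_sub_of_norm_pow_lt_one {R : Type*} [NormedRing R] [CompleteSpace R]
    {x : R} {r : ℕ} (h : ‖x ^ r‖ < 1) : IsUnit (1 - x) := by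
  have hu : IsUnit (1 - x ^ r) := isUnit_one_sub_of_norm_lt_one h
  rw [← mul_neg_geom_sum] at hu
  have hc : Commute (1 - x) (∑ i ∈ Finset.range r, x ^ i) :=
    Commute.sum_right _ _ _ fun i _ =>
      (Commute.one_left _).sub_left ((Commute.refl x).pow_right i)
  exact (hc.isUnit_mul_iff.1 hu).1

theorem mem_jacobson_of_norm_pow_lt_one {R : Type*} [NormedRing R] [CompleteSpace R]
    {x : R} (h : ∀ y : R, ∃ r : ℕ, ‖(y * x) ^ r‖ < 1) : x ∈ Ring.jacobson R := by
  rw [← Ideal.jacobson_bot, Ideal.mem_jacobson_iff]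
  -- The radical criterion asks for a left inverse of `1 + y * x`, hence the sign.
  intro y
  obtain ⟨r, hr⟩ := h (-y)
  obtain ⟨u, hu⟩ := isUnit_one_sub_of_norm_pow_lt_one hr
  refine ⟨↑u⁻¹, ?_⟩
  have : (↑u⁻¹ : R) * (1 - -y * x) = 1 := by rw [← hu]; simp
  rw [Ideal.mem_bot, sub_eq_zero, ← this]
  noncomm_ring

/-! ## Word length estimates -/

/-- `n` is a sum of `r` terms `± s` with `s ∈ S`. -/
def IsWordOfLength (S : Set ℤ) (r : ℕ) (n : ℤ) : Prop :=
  ∃ s ε : Fin r → ℤ, (∀ i, s i ∈ S) ∧ (∀ i, ε i = 1 ∨ ε i = -1) ∧ n = ∑ i, ε i * s i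

theorem IsWordOfLength.add {S : Set ℤ} {r t : ℕ} {m n : ℤ} (hm : IsWordOfLength S r m)
    (hn : IsWordOfLength S t n) : IsWordOfLength S (r + t) (m + n) := by
  obtain ⟨s, ε, hs, hε, rfl⟩ := hm
  obtain ⟨s', ε', hs', hε', rfl⟩ := hn
  refine ⟨Fin.append s s', Fin.append ε ε', fun i => ?_, fun i => ?_, ?_⟩
  · refine Fin.addCases (fun i => ?_) (fun i => ?_) i
    · simpa using hs i
    · simpa using hs' i
  · refine Fin.addCases (fun i => ?_) (fun i => ?_) i
    · simpa using hε i
    · simpa using hε' i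
  · simp [Fin.sum_univ_add]

theorem isWordOfLength_zero (S : Set ℤ) : IsWordOfLength S 0 0 :=
  ⟨Fin.elim0, Fin.elim0, fun i => i.elim0, fun i => i.elim0, by simp⟩

theorem isWordOfLength_one {S : Set ℤ} {n : ℤ} (hn : n ∈ S) : IsWordOfLength S 1 n :=
  ⟨fun _ => n, fun _ => 1, fun _ => hn, fun _ => Or.inl rfl, by simp⟩

theorem isWordOfLength_one_neg {S : Set ℤ} {n : ℤ} (hn : n ∈ S) : IsWordOfLength S 1 (-n) :=
  ⟨fun _ => n, fun _ => -1, fun _ => hn, fun _ => Or.inr rfl, by simp⟩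

theorem IsWordOfLength.wordLength_le {S : Set ℤ} {r : ℕ} {n : ℤ} (h : IsWordOfLength S r n) :
    wordLength S n ≤ r := Nat.sInf_le h

theorem exists_isWordOfLength {S : Set ℤ} (hS : (1 : ℤ) ∈ S) (n : ℤ) :
    ∃ r, IsWordOfLength S r n := by
  induction n using Int.induction_on with
  | zero => exact ⟨0, isWordOfLength_zero S⟩
  | succ n ih => exact ⟨_, ih.choose_spec.add (isWordOfLength_one hS)⟩
  | pred n ih => exact ⟨_, ih.choose_spec.add (isWordOfLength_one_neg hS)⟩

theorem isWordOfLength_wordLength {S : Set ℤ} (hS : (1 : ℤ) ∈ S) (n : ℤ) :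
    IsWordOfLength S (wordLength S n) n :=
  Nat.sInf_mem (exists_isWordOfLength hS n)

theorem wordLength_add_le {S : Set ℤ} (hS : (1 : ℤ) ∈ S) (m n : ℤ) :
    wordLength S (m + n) ≤ wordLength S m + wordLength S n :=
  ((isWordOfLength_wordLength hS m).add (isWordOfLength_wordLength hS n)).wordLength_le

theorem wordLength_zero (S : Set ℤ) : wordLength S 0 = 0 :=
  Nat.le_zero.1 (isWordOfLength_zero S).wordLength_le

theorem wordLength_le_one {S : Set ℤ} {n : ℤ} (hn : n ∈ S) : wordLength S n ≤ 1 :=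
  (isWordOfLength_one hn).wordLength_le

theorem wordLength_sum_le {S : Set ℤ} (hS : (1 : ℤ) ∈ S) {ι : Type*} (s : Finset ι) (f : ι → ℤ)
    (hf : ∀ i ∈ s, f i ∈ S) : wordLength S (∑ i ∈ s, f i) ≤ s.card := by
  classical
  induction s using Finset.induction_on with
  | empty => simp [wordLength_zero]
  | insert a s ha ih =>
    rw [Finset.sum_insert ha, Finset.card_insert_of_notMem ha, add_comm s.card]
    refine (wordLength_add_le hS _ _).trans (add_le_add (wordLength_le_one (hf a (by simp))) ?_)
    exact ih fun i hi => hf i (by simp [hi])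

theorem one_mem_squarePowers : (1 : ℤ) ∈ squarePowers := ⟨0, by simp⟩

theorem two_pow_sq_mem_squarePowers (k : ℕ) : (2 : ℤ) ^ k ^ 2 ∈ squarePowers := ⟨k, rfl⟩

/-- Collecting equal letters turns a word into an expansion in the `2 ^ l ^ 2`; cancellation can
only decrease the sum of the `|c l|`. The threshold `M` lies past every letter used. -/
theorem IsWordOfLength.exists_coeff {r : ℕ} {n : ℤ} (h : IsWordOfLength squarePowers r n) :
    ∃ (c : ℕ → ℤ) (M : ℕ), (∀ L, M ≤ L → n = ∑ l ∈ Finset.range L, c l * 2 ^ l ^ 2) ∧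
      ∀ L, ∑ l ∈ Finset.range L, |c l| ≤ r := by
  classical
  obtain ⟨s, ε, hs, hε, rfl⟩ := h
  choose k hk using hs
  refine ⟨fun l => ∑ i, if k i = l then ε i else 0, (Finset.univ.sup k) + 1, fun L hL => ?_,
    fun L => ?_⟩
  · simp only [Finset.sum_mul]
    rw [Finset.sum_comm]
    refine Finset.sum_congr rfl fun i _ => ?_
    have hi : k i ∈ Finset.range L :=
      Finset.mem_range.2 (by have := Finset.le_sup (f := k) (Finset.mem_univ i); omega)
    simp only [ite_mul, zero_mul]
    rw [Finset.sum_ite_eq, if_pos hi, ← hk i]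
  · calc ∑ l ∈ Finset.range L, |∑ i, if k i = l then ε i else 0|
        ≤ ∑ l ∈ Finset.range L, ∑ i, if k i = l then (1 : ℤ) else 0 := by
          refine Finset.sum_le_sum fun l _ => (Finset.abs_sum_le_sum_abs _ _).trans ?_
          refine Finset.sum_le_sum fun i _ => ?_
          split_ifs
          · rcases hε i with h | h <;> simp [h]
          · simp
      _ = ∑ i, ∑ l ∈ Finset.range L, if k i = l then (1 : ℤ) else 0 := Finset.sum_comm
      _ ≤ ∑ _i : Fin r, 1 := by
          refine Finset.sum_le_sum fun i _ => ?_
          rw [Finset.sum_ite_eq]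
          split_ifs <;> simp
      _ = r := by simp

/-- One position in the comparison of digits `a` and `c`: `e` is the carry in, `e'` the carry out,
`Q` the ratio of consecutive bases. Since `c - e = a - e' * Q`, a nonzero carry out forces `|c| +
|e| ≥ |e'| * Q - a`. Once `Q ≥ 2 * r + 1` this already exceeds `a + |e'|`, so only small `Q` incur
the loss `2 * r`. -/
theorem add_abs_le_of_carry {a r c e e' Q : ℤ} (ha : 0 ≤ a) (har : a ≤ r) (hQ : 1 ≤ Q)
    (he : e + (a - c) = e' * Q) :
    a + |e'| ≤ |c| + |e| + (if Q < 2 * r + 1 then 2 * r else 0) := by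
  have hc : c = a + e - e' * Q := by linarith
  have h1 : |a - e' * Q| ≤ |c| + |e| := by
    rw [show a - e' * Q = c - e by rw [hc]; ring]
    exact abs_sub _ _
  have h2 : |e'| * Q - a ≤ |a - e' * Q| := by
    have := abs_sub_abs_le_abs_sub (e' * Q) a
    rw [abs_mul, abs_of_nonneg (by linarith : 0 ≤ Q), abs_of_nonneg ha, abs_sub_comm] at this
    exact this
  have h3 := abs_nonneg e'
  split_ifs with h
  · nlinarith
  · rcases eq_or_ne e' 0 with rfl | h0
    · have := le_abs_self (a - 0 * Q)
      simp at this h1 ⊢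
      linarith
    · have h4 : 1 ≤ |e'| := Int.one_le_abs h0
      nlinarith

/-- The single-position estimates telescope in the carry. A loss at position `l` needs `2 ^ (2 * l +
1) < 2 * r + 1`, hence `l < r`, so at most `min L r` positions lose. -/
theorem sum_add_abs_le_of_carry {a c : ℕ → ℤ} {r : ℕ} (ha : ∀ l, 0 ≤ a l) (har : ∀ l, a l ≤ r)
    (L : ℕ) (e : ℤ) (he : ∑ l ∈ Finset.range L, (a l - c l) * 2 ^ l ^ 2 = e * 2 ^ L ^ 2) :
    ∑ l ∈ Finset.range L, a l + |e| ≤ ∑ l ∈ Finset.range L, |c l| + 2 * r * min L r := by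
  induction L generalizing e with
  | zero => simp at he; simp [← he]
  | succ L ih =>
    rw [Finset.sum_range_succ] at he
    have hpow : (2 : ℤ) ^ (L + 1) ^ 2 = 2 ^ (2 * L + 1) * 2 ^ L ^ 2 := by
      rw [← pow_add]; congr 1; ring
    rw [hpow] at he
    have h1 := ih (e * 2 ^ (2 * L + 1) - (a L - c L)) (by linear_combination he)
    have h2 := add_abs_le_of_carry (r := r) (c := c L) (e := e * 2 ^ (2 * L + 1) - (a L - c L))
      (e' := e) (Q := 2 ^ (2 * L + 1)) (ha L) (har L) (one_le_pow₀ (by norm_num)) (by ring)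
    rw [Finset.sum_range_succ, Finset.sum_range_succ]
    have h3 : (if (2 : ℤ) ^ (2 * L + 1) < 2 * r + 1 then 2 * (r : ℤ) else 0) +
        2 * r * min (L : ℤ) r ≤ 2 * r * min ((L + 1 : ℕ) : ℤ) r := by
      split_ifs with h
      · have hlt : ((2 * L + 1 : ℕ) : ℤ) < 2 ^ (2 * L + 1) := by
          exact_mod_cast Nat.lt_two_pow_self
        push_cast at hlt
        rw [min_eq_left (by linarith), min_eq_left (by push_cast; linarith)]
        push_cast
        linarith
      · rw [zero_add]
        gcongr
        simp
    push_cast at h1 h2 h3 ⊢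
    linarith

/-- The number of entries of `ks` that are at least `l`. -/
def countGE (ks : List ℕ) (l : ℕ) : ℤ := (ks.map fun k => if l ≤ k then (1 : ℤ) else 0).sum

theorem countGE_nonneg (ks : List ℕ) (l : ℕ) : 0 ≤ countGE ks l :=
  List.sum_nonneg fun x hx => by
    obtain ⟨k, -, rfl⟩ := List.mem_map.1 hx
    split_ifs <;> simp

theorem countGE_le_length (ks : List ℕ) (l : ℕ) : countGE ks l ≤ ks.length := by
  induction ks with
  | nil => simp [countGE]
  | cons k ks ih =>
    simp only [countGE, List.map_cons, List.sum_cons, List.length_cons] at ih ⊢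
    split_ifs <;> push_cast <;> linarith

theorem sum_countGE_mul (ks : List ℕ) {L : ℕ} (hL : ∀ k ∈ ks, k < L) (f : ℕ → ℤ) :
    ∑ l ∈ Finset.range L, countGE ks l * f l =
      (ks.map fun k => ∑ l ∈ Finset.range (k + 1), f l).sum := by
  induction ks with
  | nil => simp [countGE]
  | cons k ks ih =>
    simp only [countGE, List.map_cons, List.sum_cons, add_mul, Finset.sum_add_distrib] at ih ⊢
    rw [ih fun j hj => hL j (by simp [hj])]
    congr 1
    simp only [ite_mul, one_mul, zero_mul]
    rw [← Finset.sum_filter]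
    congr 1
    ext l
    have := hL k (by simp)
    simp only [Finset.mem_filter, Finset.mem_range]
    omega

theorem cast_sum_map_add_one (ks : List ℕ) : (((ks.map fun k => k + 1).sum : ℕ) : ℤ) =
    (ks.map fun k => ∑ _l ∈ Finset.range (k + 1), (1 : ℤ)).sum := by
  induction ks with
  | nil => simp
  | cons k ks ih =>
    rw [List.map_cons, List.sum_cons, Nat.cast_add, ih, List.map_cons, List.sum_cons]
    simp

/-- The digits `countGE ks l` expand `∑ n_k` and add up to `∑ (k + 1)`; they are compared with the
coefficients of a shortest word. -/
theorem sum_le_wordLength_add (ks : List ℕ) :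
    (ks.map fun k => k + 1).sum ≤
      wordLength squarePowers (ks.map squarePowerSum).sum + 2 * ks.length ^ 2 := by
  obtain ⟨c, M, hc, hw⟩ :=
    (isWordOfLength_wordLength one_mem_squarePowers (ks.map squarePowerSum).sum).exists_coeff
  -- Beyond all digits of both expansions, so the final carry is `0`.
  set L := max M (ks.sum + 1) with hLdef
  have hL : ∀ k ∈ ks, k < L := fun k hk =>
    lt_of_lt_of_le (Nat.lt_succ_of_le (List.single_le_sum (by simp) k hk)) (le_max_right _ _)
  have h := sum_add_abs_le_of_carry (c := c) (countGE_nonneg ks) (countGE_le_length ks) L 0 (by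
    simp only [sub_mul, Finset.sum_sub_distrib]
    rw [sum_countGE_mul ks hL, ← hc L (le_max_left _ _), zero_mul]
    exact sub_self _)
  have h1 := sum_countGE_mul ks hL fun _ => 1
  simp only [mul_one] at h1
  rw [h1, abs_zero, add_zero] at h
  have h2 : (2 * ks.length * min L ks.length : ℤ) ≤ 2 * ks.length ^ 2 := by
    rw [pow_two, ← mul_assoc]
    gcongr
    exact min_le_right _ _
  rw [← cast_sum_map_add_one] at h
  have h4 := hw L
  rw [← Nat.cast_le (α := ℤ), Nat.cast_add, Nat.cast_mul, Nat.cast_pow, Nat.cast_ofNat]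
  linarith

theorem add_one_le_wordLength_squarePowerSum (k : ℕ) :
    k + 1 ≤ wordLength squarePowers (squarePowerSum k) + 2 := by
  simpa using sum_le_wordLength_add [k]

theorem wordLength_squarePowerSum_le (k : ℕ) :
    wordLength squarePowers (squarePowerSum k) ≤ k + 1 := by
  simpa [squarePowerSum] using wordLength_sum_le one_mem_squarePowers (Finset.range (k + 1))
    (fun i => (2 : ℤ) ^ i ^ 2) fun i _ => two_pow_sq_mem_squarePowers i

/-! ### Short words for long sums -/

theorem exists_sum_squarePowerSum_eq (J : ℕ) (ks : List ℕ) (hks : ∀ k ∈ ks, J ≤ k) :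
    ∃ R : ℤ, (ks.map squarePowerSum).sum = ks.length * ∑ i ∈ Finset.range J, 2 ^ i ^ 2 + R ∧
      wordLength squarePowers R + ks.length * J ≤ (ks.map fun k => k + 1).sum := by
  induction ks with
  | nil => exact ⟨0, by simp, by simp [wordLength_zero]⟩
  | cons k ks ih =>
    obtain ⟨R, hR, hw⟩ := ih fun j hj => hks j (by simp [hj])
    have hk : J ≤ k + 1 := (hks k (by simp)).trans k.le_succ
    -- `R` gathers the terms of index at least `J`; each `k` contributes `k + 1 - J` letters to it.
    refine ⟨∑ i ∈ Finset.Ico J (k + 1), 2 ^ i ^ 2 + R, ?_, ?_⟩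
    · rw [List.map_cons, List.sum_cons, hR, squarePowerSum, List.length_cons,
        ← Finset.sum_range_add_sum_Ico _ hk]
      push_cast
      ring
    · have h1 := wordLength_add_le one_mem_squarePowers
        (∑ i ∈ Finset.Ico J (k + 1), 2 ^ i ^ 2) R
      have h2 := wordLength_sum_le one_mem_squarePowers (Finset.Ico J (k + 1))
        (fun i => (2 : ℤ) ^ i ^ 2) fun i _ => two_pow_sq_mem_squarePowers i
      rw [Nat.card_Ico] at h2
      simp only [List.length_cons, List.map_cons, List.sum_cons, add_mul, one_mul]
      omega

theorem sum_two_pow_sq_le (J : ℕ) : ∑ i ∈ Finset.range J, 2 ^ i ^ 2 ≤ 2 ^ J ^ 2 := by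
  induction J with
  | zero => simp
  | succ J ih =>
    rw [Finset.sum_range_succ]
    calc _ ≤ 2 ^ J ^ 2 + 2 ^ J ^ 2 := by gcongr
      _ = 2 ^ (J ^ 2 + 1) := by ring
      _ ≤ _ := Nat.pow_le_pow_right (by norm_num) (by rw [add_sq]; omega)

/-- Taking exactly `2 ^ J ^ 2` summands makes the low part a multiple of the generator `2 ^ J ^ 2`,
with multiplicity `∑ i < J, 2 ^ i ^ 2 ≤ 2 ^ J ^ 2`. -/
theorem wordLength_sum_squarePowerSum_add_le (J : ℕ) (ks : List ℕ) (hks : ∀ k ∈ ks, J ≤ k)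
    (hlen : ks.length = 2 ^ J ^ 2) :
    wordLength squarePowers (ks.map squarePowerSum).sum + ks.length * J ≤
      (ks.map fun k => k + 1).sum + ks.length := by
  obtain ⟨R, hR, hw⟩ := exists_sum_squarePowerSum_eq J ks hks
  have h1 := wordLength_add_le one_mem_squarePowers
    (ks.length * ∑ i ∈ Finset.range J, (2 : ℤ) ^ i ^ 2) R
  have h2 := wordLength_sum_le one_mem_squarePowers
    (Finset.range (∑ i ∈ Finset.range J, 2 ^ i ^ 2))
    (fun _ => (2 : ℤ) ^ J ^ 2) fun i _ => two_pow_sq_mem_squarePowers J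
  have h3 : ∑ _i ∈ Finset.range (∑ i ∈ Finset.range J, 2 ^ i ^ 2), (2 : ℤ) ^ J ^ 2 =
      ks.length * ∑ i ∈ Finset.range J, (2 : ℤ) ^ i ^ 2 := by
    rw [hlen]; simp [mul_comm]
  rw [h3, Finset.card_range] at h2
  have h4 := sum_two_pow_sq_le J
  rw [hR]
  omega

/-! ## The weight `n ↦ exp |n|` -/

/-- The weight `n ↦ exp |n|`, where `|n|` is the word length with respect to `S`. -/
noncomputable def wordWeight (S : Set ℤ) (hS : (1 : ℤ) ∈ S) : Weight where
  toFun n := Real.exp (wordLength S n)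
  one_le' n := Real.one_le_exp (Nat.cast_nonneg _)
  map_add_le' m n := by
    rw [← Real.exp_add, Real.exp_le_exp]
    exact_mod_cast wordLength_add_le hS m n
  map_zero' := by simp [wordLength_zero]

/-! ### Point masses and functionals on the Beurling algebra -/

namespace Beurling

variable {ω : Weight}

theorem norm_delta (n : ℤ) : ‖delta ω n‖ = ω n := by
  rw [norm_def, tsum_eq_single n fun m hm => by simp [delta_apply, hm]]
  simp [delta_apply]

theorem delta_zero : delta ω 0 = 1 := rfl

theorem delta_mul_delta (m n : ℤ) : delta ω m * delta ω n = delta ω (m + n) := by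
  ext k
  rw [mul_apply, tsum_eq_single m fun j hj => by simp [delta_apply, hj]]
  simp [delta_apply, sub_eq_iff_eq_add, add_comm]

theorem summable_pairing {φ : ℤ → ℂ} (hφ : ∀ n, ‖φ n‖ ≤ ω n) (f : Beurling ω) :
    Summable fun n => f n * φ n :=
  Summable.of_norm_bounded f.summable_weighted fun n => by
    rw [norm_mul]
    exact mul_le_mul_of_nonneg_left (hφ n) (norm_nonneg _)

/-- The functional `f ↦ ∑ f n φ n` on `ℓ¹(ℤ, ω)` given by a function `φ` with `|φ| ≤ ω`. -/
noncomputable def pairing (φ : ℤ → ℂ) (hφ : ∀ n, ‖φ n‖ ≤ ω n) : StrongDual ℂ (Beurling ω) :=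
  LinearMap.mkContinuous
    { toFun := fun f => ∑' n, f n * φ n
      map_add' := fun f g => by
        rw [← (summable_pairing hφ f).tsum_add (summable_pairing hφ g)]
        exact tsum_congr fun n => by rw [add_apply, add_mul]
      map_smul' := fun c f => by
        rw [RingHom.id_apply, smul_eq_mul, ← tsum_mul_left]
        exact tsum_congr fun n => by rw [smul_apply, mul_assoc] }
    1 fun f => by
      rw [one_mul]
      refine tsum_of_norm_bounded f.summable_weighted.hasSum fun n => ?_
      rw [norm_mul]
      exact mul_le_mul_of_nonneg_left (hφ n) (norm_nonneg _)

theorem pairing_delta (φ : ℤ → ℂ) (hφ : ∀ n, ‖φ n‖ ≤ ω n) (n : ℤ) :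
    pairing φ hφ (delta ω n) = φ n := by
  change ∑' m, delta ω n m * φ m = φ n
  rw [tsum_eq_single n fun m hm => by simp [delta_apply, hm]]
  simp [delta_apply]

/-- The normalized point mass `δ_n / ω(n)`. -/
noncomputable def unitDelta (ω : Weight) (n : ℤ) : Beurling ω := (ω n : ℂ)⁻¹ • delta ω n

theorem weight_pos (ω : Weight) (n : ℤ) : 0 < ω n := zero_lt_one.trans_le (ω.one_le n)

theorem norm_unitDelta (n : ℤ) : ‖unitDelta ω n‖ = 1 := by
  rw [unitDelta, norm_smul, norm_delta, norm_inv, Complex.norm_real,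
    Real.norm_of_nonneg (ω.nonneg n), inv_mul_cancel₀ (weight_pos ω n).ne']

theorem prod_unitDelta (ns : List ℤ) :
    (ns.map (unitDelta ω)).prod = (((ns.map ω).prod : ℝ) : ℂ)⁻¹ • delta ω ns.sum := by
  induction ns with
  | nil => simp [delta_zero]
  | cons n ns ih =>
    rw [List.map_cons, List.prod_cons, ih, unitDelta, smul_mul_smul_comm, delta_mul_delta,
      List.map_cons, List.prod_cons, List.sum_cons]
    simp [mul_comm]

theorem prod_weight_pos (ω : Weight) (ns : List ℤ) : 0 < (ns.map ω).prod :=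
  List.prod_pos fun x hx => by
    obtain ⟨n, -, rfl⟩ := List.mem_map.1 hx
    exact weight_pos ω n

theorem norm_prod_unitDelta (ns : List ℤ) :
    ‖(ns.map (unitDelta ω)).prod‖ = ω ns.sum / (ns.map ω).prod := by
  rw [prod_unitDelta, norm_smul, norm_delta, norm_inv, Complex.norm_real,
    Real.norm_of_nonneg (prod_weight_pos ω ns).le, div_eq_inv_mul]

theorem unitDelta_injective : Function.Injective (unitDelta ω) := by
  intro m n h
  by_contra hmn
  have h1 := congrArg (fun f : Beurling ω => f m) h
  have h2 : (ω m : ℂ) ≠ 0 := by exact_mod_cast (weight_pos ω m).ne'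
  simp [unitDelta, delta_apply, hmn, h2] at h1

end Beurling

/-! ### Weak-* accumulation points of the normalized point masses -/

theorem Bidual.embed_toWeakStar_injective {A : Type*} [NormedRing A] [NormedAlgebra ℂ A] :
    Function.Injective fun a : A => (embed a).toWeakStar := fun _ _ h =>
  (NormedSpace.inclusionInDoubleDualLi ℂ (E := A)).injective (StrongDual.toWeakDual.injective h)

theorem squarePowerSum_strictMono : StrictMono squarePowerSum :=
  strictMono_nat_of_lt_succ fun k => by
    rw [squarePowerSum, squarePowerSum, Finset.sum_range_succ _ (k + 1)]
    exact lt_add_of_pos_right _ (by positivity)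

/-- The normalized point masses at `n_k` with `k ≥ K`. -/
def tailPointMasses (ω : Weight) (K : ℕ) : Set (Beurling ω) :=
  (fun k => Beurling.unitDelta ω (squarePowerSum k)) '' Set.Ici K

theorem normalizedPointMasses_eq (ω : Weight) : normalizedPointMasses ω =
    (fun a => (Bidual.embed a).toWeakStar) '' tailPointMasses ω 1 := by
  ext x
  constructor
  · rintro ⟨k, hk, rfl⟩
    exact ⟨_, ⟨k, hk, rfl⟩, rfl⟩
  · rintro ⟨_, ⟨k, hk, rfl⟩, rfl⟩
    exact ⟨k, hk, rfl⟩

/-- Banach–Alaoglu: the set is infinite, by injectivity of the three maps composed, and lies in the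
weak-* compact unit ball. -/
theorem exists_accPt_normalizedPointMasses (ω : Weight) :
    ∃ Φ : Bidual (Beurling ω),
      AccPt Φ.toWeakStar (Filter.principal (normalizedPointMasses ω)) := by
  have hinf : (normalizedPointMasses ω).Infinite := by
    rw [normalizedPointMasses_eq]
    refine Set.Infinite.image Bidual.embed_toWeakStar_injective.injOn ?_
    exact (Set.Ici_infinite 1).image
      (Beurling.unitDelta_injective.comp squarePowerSum_strictMono.injective).injOn
  have hsub : normalizedPointMasses ω ⊆ WeakDual.toStrongDual ⁻¹'
      Metric.closedBall (0 : StrongDual ℂ (StrongDual ℂ (Beurling ω))) 1 := by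
    rw [normalizedPointMasses_eq]
    rintro _ ⟨_, ⟨k, -, rfl⟩, rfl⟩
    refine (mem_closedBall_zero_iff (E := StrongDual ℂ (StrongDual ℂ (Beurling ω)))).2 ?_
    exact (NormedSpace.double_dual_bound ℂ (Beurling ω) _).trans_eq (Beurling.norm_unitDelta _)
  obtain ⟨x, -, hx⟩ := hinf.exists_accPt_of_subset_isCompact
    (WeakDual.isCompact_closedBall (𝕜 := ℂ) 0 1) hsub
  exact ⟨Bidual.ofFunctional (WeakDual.toStrongDual x), hx⟩

/-- A finite set has no accumulation point, so the indices below `K` can be discarded. -/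
theorem mem_closure_of_accPt {ω : Weight} {Φ : Bidual (Beurling ω)}
    (h : AccPt Φ.toWeakStar (Filter.principal (normalizedPointMasses ω))) (K : ℕ) :
    Φ.toWeakStar ∈ closure ((fun a => (Bidual.embed a).toWeakStar) '' tailPointMasses ω K) := by
  set B := (fun a => (Bidual.embed a).toWeakStar) '' tailPointMasses ω K
  set F := (fun a => (Bidual.embed a).toWeakStar) ''
    ((fun k => Beurling.unitDelta ω (squarePowerSum k)) '' Set.Iio K)
  have hF : F.Finite := ((Set.finite_Iio K).image _).image _
  have hsub : normalizedPointMasses ω ⊆ F ∪ B := by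
    rw [normalizedPointMasses_eq]
    rintro _ ⟨_, ⟨k, -, rfl⟩, rfl⟩
    rcases lt_or_ge k K with hk | hk
    · exact Or.inl ⟨_, ⟨k, hk, rfl⟩, rfl⟩
    · exact Or.inr ⟨_, ⟨k, hk, rfl⟩, rfl⟩
  have h1 : AccPt Φ.toWeakStar (Filter.principal F ⊔ Filter.principal B) := by
    rw [Filter.sup_principal]
    exact h.mono (Filter.principal_mono.2 hsub)
  rcases accPt_sup.1 h1 with h2 | h2
  · exact absurd hF (Set.Infinite.of_accPt h2)
  · exact mem_closure_iff_clusterPt.2 h2.clusterPt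

theorem exists_list_of_forall_mem_tailPointMasses {ω : Weight} {K : ℕ} {L : List (Beurling ω)}
    (hL : ∀ a ∈ L, a ∈ tailPointMasses ω K) :
    ∃ ks : List ℕ, ks.length = L.length ∧ (∀ k ∈ ks, K ≤ k) ∧
      L = (ks.map squarePowerSum).map (Beurling.unitDelta ω) := by
  induction L with
  | nil => exact ⟨[], rfl, by simp, rfl⟩
  | cons a L ih =>
    obtain ⟨ks, h1, h2, h3⟩ := ih fun b hb => hL b (by simp [hb])
    obtain ⟨k, hk, rfl⟩ := hL a (by simp)
    exact ⟨k :: ks, by simp [h1], by simpa using ⟨hk, h2⟩, by simp [h3]⟩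

/-- The weight `n ↦ exp |n|` for the generating set `{2 ^ (k ^ 2)}`. -/
noncomputable abbrev squareWeight : Weight := wordWeight squarePowers one_mem_squarePowers

/-! ### Norms of products of normalized point masses -/

theorem squareWeight_apply (n : ℤ) :
    squareWeight n = Real.exp (wordLength squarePowers n) := rfl

theorem prod_squareWeight (ns : List ℤ) :
    (ns.map squareWeight).prod = Real.exp ((ns.map (wordLength squarePowers)).sum : ℕ) := by
  induction ns with
  | nil => simp
  | cons n ns ih =>
    rw [List.map_cons, List.prod_cons, ih, squareWeight_apply, ← Real.exp_add, List.map_cons,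
      List.sum_cons, Nat.cast_add]

theorem sum_wordLength_le (ks : List ℕ) :
    ((ks.map squarePowerSum).map (wordLength squarePowers)).sum ≤
      (ks.map fun k => k + 1).sum := by
  rw [List.map_map]
  exact List.sum_le_sum fun k _ => wordLength_squarePowerSum_le k

theorem sum_le_sum_wordLength_add (ks : List ℕ) :
    (ks.map fun k => k + 1).sum ≤
      ((ks.map squarePowerSum).map (wordLength squarePowers)).sum + 2 * ks.length := by
  induction ks with
  | nil => simp
  | cons k ks ih =>
    have := add_one_le_wordLength_squarePowerSum k
    simp only [List.map_cons, List.sum_cons, List.length_cons]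
    omega

theorem exp_neg_le_prod_div (ks : List ℕ) :
    Real.exp (-(2 * ks.length ^ 2 : ℕ)) ≤
      squareWeight (ks.map squarePowerSum).sum /
        ((ks.map squarePowerSum).map squareWeight).prod := by
  rw [prod_squareWeight, squareWeight_apply, ← Real.exp_sub, Real.exp_le_exp, le_sub_iff_add_le,
    neg_add_le_iff_le_add, ← Nat.cast_add, Nat.cast_le, add_comm]
  exact (sum_wordLength_le ks).trans (sum_le_wordLength_add ks)

/-- The `3` is `1 + 2` per factor: `1` for rewriting the low part with `2 ^ J ^ 2`, and `2` because
`|n_k|` is only known to be at least `k - 1`. -/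
theorem prod_div_le_exp (J : ℕ) (ks : List ℕ) (hks : ∀ k ∈ ks, J ≤ k)
    (hlen : ks.length = 2 ^ J ^ 2) :
    squareWeight (ks.map squarePowerSum).sum / ((ks.map squarePowerSum).map squareWeight).prod ≤
      Real.exp (3 - J) ^ ks.length := by
  rw [prod_squareWeight, squareWeight_apply, ← Real.exp_sub, ← Real.exp_nat_mul, Real.exp_le_exp]
  have h1 := (wordLength_sum_squarePowerSum_add_le J ks hks hlen).trans
    (Nat.add_le_add_right (sum_le_sum_wordLength_add ks) _)
  have h2 := (Nat.cast_le (α := ℝ)).2 h1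
  simp only [Nat.cast_add, Nat.cast_mul, Nat.cast_ofNat] at h2
  linarith

/-! ### Radical membership and non-nilpotence -/

theorem mem_jacobson_of_accPt {Φ : Bidual (Beurling squareWeight)}
    (h : AccPt Φ.toWeakStar (Filter.principal (normalizedPointMasses squareWeight))) :
    Φ ∈ Ring.jacobson (Bidual (Beurling squareWeight)) := by
  refine mem_jacobson_of_norm_pow_lt_one fun Ψ => ?_
  -- Chosen so that `exp(J - 3) ≥ J - 2 > ‖Ψ‖`, which makes `‖Ψ‖ * exp(3 - J) < 1`.
  obtain ⟨J, hJ⟩ := exists_nat_gt (‖Ψ‖ + 3)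
  refine ⟨2 ^ J ^ 2, ?_⟩
  have hb := Bidual.norm_pow_le (mem_closure_of_accPt h J) Ψ (r := 2 ^ J ^ 2)
    (C := Real.exp (3 - J) ^ 2 ^ J ^ 2) (by positivity) fun L hL hT => by
      obtain ⟨ks, h1, h2, rfl⟩ := exists_list_of_forall_mem_tailPointMasses hT
      rw [Beurling.norm_prod_unitDelta]
      have h3 : ks.length = 2 ^ J ^ 2 := by simpa using hL
      exact (prod_div_le_exp J ks h2 h3).trans_eq (by rw [h3])
  have hone : ‖(1 : Beurling squareWeight)‖ = 1 := by
    rw [← Beurling.delta_zero, Beurling.norm_delta]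
    exact squareWeight.map_zero'
  rw [hone, mul_one, ← mul_pow] at hb
  refine hb.trans_lt (pow_lt_one₀ (by positivity) ?_ (by positivity))
  calc ‖Ψ‖ * Real.exp (3 - J) < Real.exp (J - 3) * Real.exp (3 - J) := by
        refine mul_lt_mul_of_pos_right ?_ (Real.exp_pos _)
        have := Real.add_one_le_exp ((J : ℝ) - 3)
        linarith
    _ = 1 := by rw [← Real.exp_add]; simp

theorem not_isNilpotent_of_accPt {Φ : Bidual (Beurling squareWeight)}
    (h : AccPt Φ.toWeakStar (Filter.principal (normalizedPointMasses squareWeight))) :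
    ¬ IsNilpotent Φ := by
  rintro ⟨r, hr⟩
  have hφ : ∀ n, ‖((squareWeight n : ℝ) : ℂ)‖ ≤ squareWeight n := fun n => by
    rw [Complex.norm_real, Real.norm_of_nonneg (squareWeight.nonneg n)]
  have hD : IsClosed {z : ℂ | Real.exp (-(2 * r ^ 2 : ℕ)) ≤ z.re} :=
    isClosed_le continuous_const Complex.continuous_re
  -- The functional `f ↦ ∑ f n * ω n` takes on each product of normalized point masses its norm as
  -- value. A closed half-plane carries this lower bound to the limit and excludes `0`.
  have hmem := Bidual.pow_toFunctional_mem (mem_closure_of_accPt h 0) hD r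
    (Beurling.pairing (fun n => (squareWeight n : ℂ)) hφ) fun L hL hT => by
      obtain ⟨ks, h1, -, rfl⟩ := exists_list_of_forall_mem_tailPointMasses hT
      rw [Beurling.prod_unitDelta, map_smul, Beurling.pairing_delta, smul_eq_mul,
        ← Complex.ofReal_inv, ← Complex.ofReal_mul, Set.mem_ofPred_eq, Complex.ofReal_re,
        ← div_eq_inv_mul]
      have h3 : ks.length = r := by simpa using hL
      rw [← h3]
      exact exp_neg_le_prod_div ks
  rw [hr] at hmem
  exact (Real.exp_pos _).not_ge hmem

theorem theorem1p2 :
    ∃ ω : Weight, (∀ n : ℤ, ω n = Real.exp (wordLength squarePowers n)) ∧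
      (∃ Φ : Bidual (Beurling ω), Φ ∈ Ring.jacobson (Bidual (Beurling ω)) ∧ ¬ IsNilpotent Φ) ∧
      (∃ Φ : Bidual (Beurling ω),
        AccPt Φ.toWeakStar (Filter.principal (normalizedPointMasses ω))) ∧
      ∀ Φ : Bidual (Beurling ω),
        AccPt Φ.toWeakStar (Filter.principal (normalizedPointMasses ω)) →
          Φ ∈ Ring.jacobson (Bidual (Beurling ω)) ∧ ¬ IsNilpotent Φ := by
  obtain ⟨Φ, hΦ⟩ := exists_accPt_normalizedPointMasses squareWeight
  exact ⟨squareWeight, squareWeight_apply,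
    ⟨Φ, mem_jacobson_of_accPt hΦ, not_isNilpotent_of_accPt hΦ⟩, ⟨Φ, hΦ⟩,
    fun Ψ hΨ => ⟨mem_jacobson_of_accPt hΨ, not_isNilpotent_of_accPt hΨ⟩⟩
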